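/- Let $X$ be a compact smooth $4$-manifold with a hypercomplex structure, i.e. integrable complex structure operators $I,J,K\colon TX\to TX$ with $IJ=-JI=K$, and let $g$ be a strong HKT metric on $(X,I,J,K)$: a Riemannian metric that is Hermitian for every induced complex structure $L=aI+bJ+cK$ ($a,b,c\in\mathbb R$, $a^2+b^2+c^2=1$) and satisfies $$d^c_I\omega_I=d^c_J\omega_J=d^c_K\omega_K=H,\qquad dH=0,$$ for some $3$-form $H$, where $\omega_L(\cdot,\cdot)=g(L\cdot,\cdot)$ and $d^c_L=(-1)^m\,L\circ d\circ L$ on $m$-forms. Orient $X$ by its complex structures (all induced $L$ give the same orientation). Let $E$ be a smooth complex vector bundle on $X$ with a Hermitian metric $h$, and let $A$ be a smooth $h$-unitary connection in $E$ with curvature $F_A$. Call $A$ integrable with respect to $L$ if the $(0,2)$-part of $F_A$ with respect to $L$ vanishes, i.e. $\bar\partial_A\circ\bar\partial_A=0$ on $(X,L)$; hyperholomorphic if it is integrable with respect to every induced complex structure $L$; and anti-self-dual if $*F_A=-F_A$, where $*$ is the Hodge star of $g$. Then $A$ is hyperholomorphic if and only if $A$ is anti-self-dual. -/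

import Mathlib

open Bundle VectorField Topology
open scoped Manifold ContDiff InnerProductSpace

set_option linter.unusedSectionVars false

noncomputable section

namespace HKT

/-- The model space of a real 4-manifold. -/
abbrev E4 : Type := EuclideanSpace ℝ (Fin 4)

section Sections

variable {X : Type*} [TopologicalSpace X] [ChartedSpace E4 X]
  (F : Type*) [NormedAddCommGroup F] [NormedSpace ℝ F]
  {V : X → Type*} [TopologicalSpace (TotalSpace F V)] [∀ x, TopologicalSpace (V x)]
  [FiberBundle F V]

/-- `σ` is a smooth section of the bundle `V` (with model fibre `F`). -/
abbrev IsSmoothSection (σ : Π x, V x) : Prop :=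
  ContMDiff (𝓡 4) ((𝓡 4).prod 𝓘(ℝ, F)) ∞ (fun x ↦ TotalSpace.mk' F x (σ x))

/-- `σ` is smooth in a neighbourhood of `x`. -/
abbrev SmoothNear (σ : Π x, V x) (x : X) : Prop :=
  ∃ u : Set X, IsOpen u ∧ x ∈ u ∧
    ContMDiffOn (𝓡 4) ((𝓡 4).prod 𝓘(ℝ, F)) ∞ (fun x ↦ TotalSpace.mk' F x (σ x)) u

/-- `σ` is differentiable at `x`. -/
abbrev DiffAt (σ : Π x, V x) (x : X) : Prop :=
  MDifferentiableAt (𝓡 4) ((𝓡 4).prod 𝓘(ℝ, F)) (fun y ↦ TotalSpace.mk' F y (σ y)) x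

lemma SmoothNear.diff {σ : Π x, V x} {x : X} (h : SmoothNear F σ x) :
    ∀ᶠ y in 𝓝 x, DiffAt F σ y := by
  obtain ⟨u, hu, hx, hs⟩ := h
  filter_upwards [hu.mem_nhds hx] with y hy
  exact ((hs y hy).contMDiffAt (hu.mem_nhds hy)).mdifferentiableAt (by simp)

lemma SmoothNear.diffAt {σ : Π x, V x} {x : X} (h : SmoothNear F σ x) : DiffAt F σ x :=
  (SmoothNear.diff F h).self_of_nhds

end Sections

section Forms

variable {X : Type*} [TopologicalSpace X] [ChartedSpace E4 X]

/-- Differential `n`-forms on `X`, without any regularity. -/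
abbrev Form (X : Type*) [TopologicalSpace X] [ChartedSpace E4 X] (n : ℕ) : Type _ :=
  Π x : X, TangentSpace (𝓡 4) x [⋀^Fin n]→L[ℝ] ℝ

/-- Fields of endomorphisms of the tangent spaces. -/
abbrev EndField (X : Type*) [TopologicalSpace X] [ChartedSpace E4 X] : Type _ :=
  Π x : X, TangentSpace (𝓡 4) x →L[ℝ] TangentSpace (𝓡 4) x

/-- The form `α` in the chart around `x₀`: its pull-back under the inverse of the chart. -/
def formInChart {n : ℕ} (α : Form X n) (x₀ : X) (y : E4) : E4 [⋀^Fin n]→L[ℝ] ℝ :=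
  (α ((extChartAt (𝓡 4) x₀).symm y)).compContinuousLinearMap
    (mfderiv 𝓘(ℝ, E4) (𝓡 4) (extChartAt (𝓡 4) x₀).symm y)

/-- The exterior derivative on `X`, computed at `x` in the chart around `x`. -/
def extDerivForm {n : ℕ} (α : Form X n) : Form X (n + 1) := fun x ↦
  (extDeriv (formInChart α x) (extChartAt (𝓡 4) x x)).compContinuousLinearMap
    (mfderiv (𝓡 4) 𝓘(ℝ, E4) (extChartAt (𝓡 4) x) x)

/-- The action of a field of endomorphisms on forms, `(Lα)(v₁, …) = α(L v₁, …)`. -/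
def endAct {n : ℕ} (L : EndField X) (α : Form X n) : Form X n :=
  fun x ↦ (α x).compContinuousLinearMap (L x)

/-- The twisted differential, `d^c_L = (-1)^n L ∘ d ∘ L` on `n`-forms. -/
def dc {n : ℕ} (L : EndField X) (α : Form X n) : Form X (n + 1) :=
  (-1 : ℝ) ^ n • endAct L (extDerivForm (endAct L α))

variable [IsManifold (𝓡 4) ∞ X]

/-- A complex structure operator on `X`: a smooth field `L` of endomorphisms with `L² = -1` and
vanishing Nijenhuis tensor. -/
structure IsComplexStructure (L : EndField X) : Prop where
  smooth : ContMDiff (𝓡 4) ((𝓡 4).prod 𝓘(ℝ, E4 →L[ℝ] E4)) ∞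
    (fun x ↦ TotalSpace.mk' (E4 →L[ℝ] E4)
      (E := fun x : X ↦ TangentSpace (𝓡 4) x →L[ℝ] TangentSpace (𝓡 4) x) x (L x))
  sq : ∀ x v, L x (L x v) = -v
  nijenhuis : ∀ Y Z : Π x : X, TangentSpace (𝓡 4) x, IsSmoothSection E4 Y → IsSmoothSection E4 Z →
    ∀ x, mlieBracket (𝓡 4) (fun y ↦ L y (Y y)) (fun y ↦ L y (Z y)) x
      - L x (mlieBracket (𝓡 4) (fun y ↦ L y (Y y)) Z x)
      - L x (mlieBracket (𝓡 4) Y (fun y ↦ L y (Z y)) x)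
      - mlieBracket (𝓡 4) Y Z x = 0

/-- A hypercomplex structure: complex structure operators with `IJ = -JI = K`. -/
structure HypercomplexStructure (X : Type*) [TopologicalSpace X] [ChartedSpace E4 X]
    [IsManifold (𝓡 4) ∞ X] where
  I : EndField X
  J : EndField X
  K : EndField X
  isComplex_I : IsComplexStructure I
  isComplex_J : IsComplexStructure J
  isComplex_K : IsComplexStructure K
  I_J : ∀ x v, I x (J x v) = K x v
  J_I : ∀ x v, J x (I x v) = -K x v

/-- The induced structure `aI + bJ + cK` (used for `a² + b² + c² = 1`). -/
def HypercomplexStructure.induced (S : HypercomplexStructure X) (a b c : ℝ) : EndField X :=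
  fun x ↦ a • S.I x + b • S.J x + c • S.K x

/-! The Riemannian metric is the inner product on the tangent spaces given by a
`RiemannianBundle` instance. -/

section Metric
variable [RiemannianBundle (fun x : X ↦ TangentSpace (𝓡 4) x)]

/-- The metric is Hermitian for `L`. -/
def IsHermitian (L : EndField X) : Prop :=
  ∀ (x : X) (u v : TangentSpace (𝓡 4) x), ⟪L x u, L x v⟫_ℝ = ⟪u, v⟫_ℝ

/-- The Hermitian form `ω_L(u, v) = g(Lu, v)`. -/
def hermitianForm (L : EndField X) (hL : IsComplexStructure L) (hg : IsHermitian L) : Form X 2 :=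
  fun x ↦
  { toFun := fun w ↦ ⟪L x (w 0), w 1⟫_ℝ
    map_update_add' := by
      intro inst w i u v
      rw [Subsingleton.elim inst (instDecidableEqFin 2)]
      fin_cases i <;> simp [inner_add_left, inner_add_right]
    map_update_smul' := by
      intro inst w i c u
      rw [Subsingleton.elim inst (instDecidableEqFin 2)]
      fin_cases i <;> simp [inner_smul_left, inner_smul_right]
    map_eq_zero_of_eq' := by
      intro w i j h hij
      have h01 : w 0 = w 1 := by
        fin_cases i <;> fin_cases j <;> simp_all
      have h1 := hg x (L x (w 1)) (w 1)
      rw [hL.sq, inner_neg_left, real_inner_comm] at h1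
      simp only [h01]
      linarith
    cont := by fun_prop }

/-- The metric is Hermitian for all complex structures induced by `I, J, K`. -/
def HypercomplexStructure.IsHyperhermitian (S : HypercomplexStructure X) : Prop :=
  ∀ a b c : ℝ, a ^ 2 + b ^ 2 + c ^ 2 = 1 → IsHermitian (S.induced a b c)

lemma HypercomplexStructure.IsHyperhermitian.I {S : HypercomplexStructure X}
    (h : S.IsHyperhermitian) : IsHermitian S.I := by
  have := h 1 0 0 (by norm_num)
  intro x u v
  simpa [induced] using this x u v

lemma HypercomplexStructure.IsHyperhermitian.J {S : HypercomplexStructure X}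
    (h : S.IsHyperhermitian) : IsHermitian S.J := by
  have := h 0 1 0 (by norm_num)
  intro x u v
  simpa [induced] using this x u v

lemma HypercomplexStructure.IsHyperhermitian.K {S : HypercomplexStructure X}
    (h : S.IsHyperhermitian) : IsHermitian S.K := by
  have := h 0 0 1 (by norm_num)
  intro x u v
  simpa [induced] using this x u v

/-- The metric is strong HKT: hyperhermitian, with `d^c_I ω_I = d^c_J ω_J = d^c_K ω_K = H` for a
closed 3-form `H`. -/
structure HypercomplexStructure.IsStrongHKT (S : HypercomplexStructure X) : Prop where
  hyperhermitian : S.IsHyperhermitian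
  exists_torsion : ∃ H : Form X 3,
    dc S.I (hermitianForm S.I S.isComplex_I hyperhermitian.I) = H ∧
    dc S.J (hermitianForm S.J S.isComplex_J hyperhermitian.J) = H ∧
    dc S.K (hermitianForm S.K S.isComplex_K hyperhermitian.K) = H ∧
    extDerivForm H = 0

end Metric

instance tangentSpace_fact_finrank (x : X) :
    Fact (Module.finrank ℝ (TangentSpace (𝓡 4) x) = 4) :=
  ⟨finrank_euclideanSpace_fin (𝕜 := ℝ) (n := 4)⟩

instance tangentSpace_nontrivial (x : X) : Nontrivial (TangentSpace (𝓡 4) x) :=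
  inferInstanceAs (Nontrivial E4)

instance tangentSpace_finiteDimensional (x : X) : FiniteDimensional ℝ (TangentSpace (𝓡 4) x) :=
  inferInstanceAs (FiniteDimensional ℝ E4)

lemma HypercomplexStructure.linearIndependent (S : HypercomplexStructure X) {x : X}
    {u : TangentSpace (𝓡 4) x} (hu : u ≠ 0) :
    LinearIndependent ℝ ![u, S.I x u, S.J x u, S.K x u] := by
  rw [Fintype.linearIndependent_iff]
  intro c hc
  have e : c 0 • u + c 1 • S.I x u + c 2 • S.J x u + c 3 • S.K x u = 0 := by
    simpa [Fin.sum_univ_four] using hc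
  have hI := congrArg (S.I x) e
  have hJ := congrArg (S.J x) e
  have hK := congrArg (S.K x) e
  have IJ := S.I_J x
  have JI := S.J_I x
  have II := S.isComplex_I.sq x
  have JJ := S.isComplex_J.sq x
  have IK : ∀ v, S.I x (S.K x v) = - S.J x v := fun v ↦ by rw [← IJ, II]
  have KJ : ∀ v, S.K x (S.J x v) = - S.I x v := fun v ↦ by rw [← IJ, JJ, map_neg]
  have KI : ∀ v, S.K x (S.I x v) = S.J x v := fun v ↦ by rw [← IJ, JI, map_neg, IK, neg_neg]
  have JK : ∀ v, S.J x (S.K x v) = S.I x v := fun v ↦ by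
    have : S.K x v = - S.J x (S.I x v) := by rw [JI, neg_neg]
    rw [this, map_neg, JJ, neg_neg]
  have KK := S.isComplex_K.sq x
  simp only [map_add, map_smul, IJ, JI, II, JJ, KK, IK, KJ, KI, JK, map_zero] at hI hJ hK
  have key : (c 0 ^ 2 + c 1 ^ 2 + c 2 ^ 2 + c 3 ^ 2) • u = 0 := by
    have : (c 0 ^ 2 + c 1 ^ 2 + c 2 ^ 2 + c 3 ^ 2) • u =
      c 0 • (c 0 • u + c 1 • S.I x u + c 2 • S.J x u + c 3 • S.K x u) -
      c 1 • (c 0 • S.I x u + c 1 • (-u) + c 2 • S.K x u + c 3 • (-S.J x u)) -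
      c 2 • (c 0 • S.J x u + c 1 • (-S.K x u) + c 2 • (-u) + c 3 • (S.I x u)) -
      c 3 • (c 0 • S.K x u + c 1 • (S.J x u) + c 2 • (-S.I x u) + c 3 • (-u)) := by
      module
    rw [this, e, hI, hJ, hK]
    simp
  have hs := (smul_eq_zero.1 key).resolve_right hu
  have h0 := sq_nonneg (c 0)
  have h1 := sq_nonneg (c 1)
  have h2 := sq_nonneg (c 2)
  have h3 := sq_nonneg (c 3)
  have z0 : c 0 = 0 := (pow_eq_zero_iff two_ne_zero).1 (by linarith)
  have z1 : c 1 = 0 := (pow_eq_zero_iff two_ne_zero).1 (by linarith)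
  have z2 : c 2 = 0 := (pow_eq_zero_iff two_ne_zero).1 (by linarith)
  have z3 : c 3 = 0 := (pow_eq_zero_iff two_ne_zero).1 (by linarith)
  intro i
  fin_cases i
  exacts [z0, z1, z2, z3]

/-- The basis `(u, Iu, Ju, Ku)` of a tangent space, for `u ≠ 0`. -/
def HypercomplexStructure.frame (S : HypercomplexStructure X) {x : X}
    {u : TangentSpace (𝓡 4) x} (hu : u ≠ 0) : Module.Basis (Fin 4) ℝ (TangentSpace (𝓡 4) x) :=
  basisOfLinearIndependentOfCardEqFinrank (S.linearIndependent hu)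
    (by rw [(inferInstance : Fact (Module.finrank ℝ (TangentSpace (𝓡 4) x) = 4)).out]; simp)

/-- The orientation of `X` as a complex surface, in which `(u, Iu, w, Iw)` is positive; here `w = Ju`
and `u` is some non-zero vector. All complex structures induced by `I, J, K` and all `u` give the
same orientation. -/
def HypercomplexStructure.orientation (S : HypercomplexStructure X) (x : X) :
    Orientation ℝ (TangentSpace (𝓡 4) x) (Fin 4) :=
  (S.frame (exists_ne (0 : TangentSpace (𝓡 4) x)).choose_spec).orientation

end Forms

section Hodge

variable {T : Type*} [NormedAddCommGroup T] [InnerProductSpace ℝ T]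
  [Fact (Module.finrank ℝ T = 4)] {W : Type*} [AddCommGroup W] [Module ℝ W]

/-- The Hodge star on 2-forms on an oriented Euclidean 4-space with values in a vector space,
`(∗β)(u, v) = ½ ∑ᵢⱼ vol(eᵢ, eⱼ, u, v) β(eᵢ, eⱼ)` for an orthonormal basis `e`. -/
def hodgeStar (o : Orientation ℝ T (Fin 4)) (β : T [⋀^Fin 2]→ₗ[ℝ] W) : T [⋀^Fin 2]→ₗ[ℝ] W :=
  haveI : FiniteDimensional ℝ T := .of_fact_finrank_eq_succ 3
  let e := stdOrthonormalBasis ℝ T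
  (1 / 2 : ℝ) • ∑ i, ∑ j, (LinearMap.toSpanSingleton ℝ W (β ![e i, e j])).compAlternatingMap
    ((o.volumeForm.curryLeft (e i)).curryLeft (e j))

end Hodge

section Connection

/-! A smooth complex vector bundle on `X` is a fibre bundle `V` that is a vector bundle over `ℂ`
and whose transition functions are smooth over `ℝ`. -/

variable {X : Type*} [TopologicalSpace X] [ChartedSpace E4 X] [IsManifold (𝓡 4) ∞ X]
  (F : Type*) [NormedAddCommGroup F] [NormedSpace ℂ F]
  (V : X → Type*) [TopologicalSpace (TotalSpace F V)]
  [∀ x, AddCommGroup (V x)] [∀ x, Module ℂ (V x)] [∀ x, TopologicalSpace (V x)]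
  [∀ x, IsTopologicalAddGroup (V x)] [∀ x, ContinuousSMul ℝ (V x)]
  [FiberBundle F V] [VectorBundle ℂ F V] [VectorBundle ℝ F V]
  [ContMDiffVectorBundle ∞ F V (𝓡 4)]

/-- A smooth `ℂ`-linear connection in `V`. -/
structure ComplexConnection extends CovariantDerivative (𝓡 4) F V where
  smooth : CovariantDerivative.ContMDiffCovariantDerivative toCovariantDerivative ∞
  map_smul : ∀ (c : ℂ) (σ : Π x, V x) (x : X), DiffAt F σ x → ∀ v : TangentSpace (𝓡 4) x,
    toCovariantDerivative (fun y ↦ c • σ y) x v = c • toCovariantDerivative σ x v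

/-- A smooth Hermitian metric in `V`, conjugate-linear in the first variable. -/
structure HermitianMetric where
  inner : Π x, V x →ₗ⋆[ℂ] V x →ₗ[ℂ] ℂ
  conj_symm : ∀ x (s t : V x), starRingEnd ℂ (inner x s t) = inner x t s
  pos : ∀ x (s : V x), s ≠ 0 → 0 < (inner x s s).re
  smooth : ∀ σ τ : Π x, V x, IsSmoothSection F σ → IsSmoothSection F τ →
    ContMDiff (𝓡 4) 𝓘(ℝ, ℂ) ∞ (fun x ↦ inner x (σ x) (τ x))

variable {F V}

/-- `A` is `h`-unitary: `d h(σ, τ) = h(∇σ, τ) + h(σ, ∇τ)`. -/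
def ComplexConnection.IsUnitary (h : HermitianMetric F V) (A : ComplexConnection F V) : Prop :=
  ∀ σ τ : Π x, V x, IsSmoothSection F σ → IsSmoothSection F τ →
    ∀ (x : X) (v : TangentSpace (𝓡 4) x),
      mfderiv (𝓡 4) 𝓘(ℝ, ℂ) (fun y ↦ h.inner y (σ y) (τ y)) x v =
        h.inner x (A.toCovariantDerivative σ x v) (τ x) +
          h.inner x (σ x) (A.toCovariantDerivative τ x v)

/-- The extension of `s ∈ V x` to a section that is constant in the trivialization around `x`. -/
def secExtend (F : Type*) [NormedAddCommGroup F] [NormedSpace ℂ F]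
    {V : X → Type*} [TopologicalSpace (TotalSpace F V)] [∀ x, AddCommGroup (V x)]
    [∀ x, Module ℂ (V x)] [∀ x, TopologicalSpace (V x)] [FiberBundle F V] [VectorBundle ℂ F V]
    {x : X} (s : V x) : Π y, V y := fun y ↦
  (trivializationAt F V x).symmₗ ℂ y ((trivializationAt F V x).linearMapAt ℂ x s)

/-- The extension of a tangent vector to a vector field that is constant in the trivialization
around its base point. -/
def vecExtend {x : X} (u : TangentSpace (𝓡 4) x) : Π y : X, TangentSpace (𝓡 4) y := fun y ↦
  (trivializationAt E4 (TangentSpace (𝓡 4)) x).symmₗ ℝ y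
    ((trivializationAt E4 (TangentSpace (𝓡 4)) x).linearMapAt ℝ x u)

lemma smoothNear_secExtend {x : X} (s : V x) : SmoothNear F (secExtend F s) x := by
  obtain ⟨w, hw, hs⟩ := FiberBundle.exists_contMDiffOn_extend (k := ∞) (𝓡 4) F s
  have hx : x ∈ (trivializationAt F V x).baseSet := FiberBundle.mem_baseSet_trivializationAt' x
  obtain ⟨u, hu, huo, hxu⟩ := mem_nhds_iff.1
    (Filter.inter_mem hw ((trivializationAt F V x).open_baseSet.mem_nhds hx))
  refine ⟨u, huo, hxu, (hs.mono fun y hy ↦ (hu hy).1).congr fun y hy ↦ ?_⟩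
  rw [secExtend, Trivialization.symmₗ_apply _ (hu hy).2, Trivialization.coe_linearMapAt_of_mem _ hx]
  rfl

lemma smoothNear_vecExtend {x : X} (s : TangentSpace (𝓡 4) x) : SmoothNear E4 (vecExtend s) x := by
  obtain ⟨w, hw, hs⟩ := FiberBundle.exists_contMDiffOn_extend (k := ∞) (𝓡 4) E4 s
  have hx : x ∈ (trivializationAt E4 (TangentSpace (𝓡 4)) x).baseSet :=
    FiberBundle.mem_baseSet_trivializationAt' x
  obtain ⟨u, hu, huo, hxu⟩ := mem_nhds_iff.1
    (Filter.inter_mem hw ((trivializationAt E4 (TangentSpace (𝓡 4)) x).open_baseSet.mem_nhds hx))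
  refine ⟨u, huo, hxu, (hs.mono fun y hy ↦ (hu hy).1).congr fun y hy ↦ ?_⟩
  rw [vecExtend, Trivialization.symmₗ_apply _ (hu hy).2, Trivialization.coe_linearMapAt_of_mem _ hx]
  rfl

lemma secExtend_add {x : X} (s t : V x) : secExtend F (s + t) = secExtend F s + secExtend F t := by
  ext y; simp only [secExtend, map_add, Pi.add_apply]

lemma secExtend_smul {x : X} (c : ℂ) (s : V x) :
    secExtend F (c • s) = fun y ↦ c • secExtend F s y := by
  ext y; simp only [secExtend, map_smul]

lemma vecExtend_add {x : X} (s t : TangentSpace (𝓡 4) x) :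
    vecExtend (s + t) = vecExtend s + vecExtend t := by
  ext1 y; simp only [vecExtend, map_add, Pi.add_apply]

lemma vecExtend_smul {x : X} (c : ℝ) (s : TangentSpace (𝓡 4) x) :
    vecExtend (c • s) = c • vecExtend s := by
  ext1 y; simp only [vecExtend, map_smul, Pi.smul_apply]

lemma secExtend_self {x : X} (s : V x) : secExtend F s x = s :=
  Trivialization.symmₗ_linearMapAt _ (FiberBundle.mem_baseSet_trivializationAt' x) s

lemma vecExtend_self {x : X} (s : TangentSpace (𝓡 4) x) : vecExtend s x = s :=
  Trivialization.symmₗ_linearMapAt _ (FiberBundle.mem_baseSet_trivializationAt' x) s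

lemma ComplexConnection.smoothAt [T2Space X] (A : ComplexConnection F V) {σ : Π x, V x} {x : X}
    (h : SmoothNear F σ x) :
    MDifferentiableAt (𝓡 4) ((𝓡 4).prod 𝓘(ℝ, E4 →L[ℝ] F))
      (fun y ↦ TotalSpace.mk' (E4 →L[ℝ] F)
        (E := fun y : X ↦ TangentSpace (𝓡 4) y →L[ℝ] V y) y (A.toCovariantDerivative σ y)) x := by
  obtain ⟨u, hu, hx, hs⟩ := id h
  obtain ⟨ρ, hρ⟩ : ∃ ρ : SmoothBumpFunction (𝓡 4) x, tsupport ρ ⊆ u := by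
    simpa using ((SmoothBumpFunction.nhds_basis_tsupport (I := 𝓡 4) x).mem_iff.1 (hu.mem_nhds hx))
  have hg : ContMDiff (𝓡 4) ((𝓡 4).prod 𝓘(ℝ, F)) ∞ (fun y ↦ TotalSpace.mk' F y ((⇑ρ • σ) y)) :=
    ContMDiffOn.smul_section_of_tsupport ρ.contMDiff.contMDiffOn hu hρ hs
  have hA := A.smooth.contMDiff.contMDiff (σ := ⇑ρ • σ) hg.contMDiffOn
  have hA' := (hA x (Set.mem_univ x)).contMDiffAt Filter.univ_mem |>.mdifferentiableAt (by simp)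
  refine hA'.congr_of_eventuallyEq ?_
  filter_upwards [ρ.eventuallyEq_one.eventually_nhds, SmoothNear.diff F h] with y hy hd
  congr 1
  refine A.isCovariantDerivativeOnUniv.congr_of_eventuallyEq hd
    (hg.contMDiffAt.mdifferentiableAt (by simp)) Filter.univ_mem ?_
  filter_upwards [hy] with z hz
  simp [hz]

/-- The covariant derivative `∇_Y σ`. -/
abbrev Cov (A : ComplexConnection F V) (Y : Π x : X, TangentSpace (𝓡 4) x) (σ : Π x, V x) :
    Π x, V x :=
  fun x ↦ A.toCovariantDerivative σ x (Y x)

namespace ComplexConnection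

/-- `F_A(Y, Z) σ = ∇_Y ∇_Z σ - ∇_Z ∇_Y σ - ∇_{[Y, Z]} σ`. -/
def curvatureField (A : ComplexConnection F V) (Y Z : Π x : X, TangentSpace (𝓡 4) x)
    (σ : Π x, V x) (x : X) : V x :=
  Cov A Y (Cov A Z σ) x - Cov A Z (Cov A Y σ) x - Cov A (mlieBracket (𝓡 4) Y Z) σ x

variable [T2Space X] (A : ComplexConnection F V) {Y Y' Z : Π x : X, TangentSpace (𝓡 4) x}
  {σ τ : Π x, V x} {x : X}

lemma diffAt_cov (hY : DiffAt E4 Y x) (hσ : SmoothNear F σ x) : DiffAt F (Cov A Y σ) x :=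
  MDifferentiableAt.clm_bundle_apply (A.smoothAt hσ) hY

lemma curvatureField_add_left (hY : DiffAt E4 Y x) (hY' : DiffAt E4 Y' x)
    (hσ : SmoothNear F σ x) :
    A.curvatureField (Y + Y') Z σ x = A.curvatureField Y Z σ x + A.curvatureField Y' Z σ x := by
  have h1 : Cov A (Y + Y') σ = Cov A Y σ + Cov A Y' σ := by ext y; simp [Cov]
  have h2 := A.isCovariantDerivativeOnUniv.add (A.diffAt_cov hY hσ) (A.diffAt_cov hY' hσ)
  have h3 := mlieBracket_add_left (W := Z) hY hY'
  rw [curvatureField, h1]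
  simp only [Cov, curvatureField, h3, h2, Pi.add_apply, map_add, add_apply]
  abel

lemma curvatureField_smul_left (c : ℝ) (hY : DiffAt E4 Y x) (hσ : SmoothNear F σ x) :
    A.curvatureField (c • Y) Z σ x = c • A.curvatureField Y Z σ x := by
  have h1 : Cov A (c • Y) σ = c • Cov A Y σ := by ext y; simp [Cov]
  have h2 := A.isCovariantDerivativeOnUniv.smul_const c (A.diffAt_cov hY hσ)
  have h3 := mlieBracket_const_smul_left (c := c) (W := Z) hY
  rw [curvatureField, h1]
  simp only [Cov, curvatureField, h3, Pi.smul_apply]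
  rw [h2]
  simp [smul_sub]

lemma curvatureField_swap : A.curvatureField Z Y σ x = - A.curvatureField Y Z σ x := by
  simp only [curvatureField, Cov]
  rw [mlieBracket_swap]
  simp only [Pi.neg_apply, map_neg]
  abel

lemma curvatureField_add (hY : DiffAt E4 Y x) (hZ : DiffAt E4 Z x)
    (hσ : SmoothNear F σ x) (hτ : SmoothNear F τ x) :
    A.curvatureField Y Z (σ + τ) x = A.curvatureField Y Z σ x + A.curvatureField Y Z τ x := by
  have key : ∀ W : Π x : X, TangentSpace (𝓡 4) x, DiffAt E4 W x →
      A.toCovariantDerivative (Cov A W (σ + τ)) x =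
      A.toCovariantDerivative (Cov A W σ) x + A.toCovariantDerivative (Cov A W τ) x := by
    intro W hW
    have e : ∀ᶠ y in 𝓝 x, Cov A W (σ + τ) y = (Cov A W σ + Cov A W τ) y := by
      filter_upwards [SmoothNear.diff F hσ, SmoothNear.diff F hτ] with y h1 h2
      simp [Cov, A.isCovariantDerivativeOnUniv.add h1 h2]
    have d := mdifferentiableAt_add_section (A.diffAt_cov hW hσ) (A.diffAt_cov hW hτ)
    rw [← A.isCovariantDerivativeOnUniv.add (A.diffAt_cov hW hσ) (A.diffAt_cov hW hτ)]
    refine A.isCovariantDerivativeOnUniv.congr_of_eventuallyEq ?_ d Filter.univ_mem e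
    refine d.congr_of_eventuallyEq ?_
    filter_upwards [e] with y hy using by rw [hy]
  simp only [curvatureField]
  unfold Cov
  have k1 := key Y hY
  have k2 := key Z hZ
  unfold Cov at k1 k2
  rw [k1, k2, A.isCovariantDerivativeOnUniv.add (SmoothNear.diffAt F hσ) (SmoothNear.diffAt F hτ)]
  simp only [add_apply]
  abel

lemma diffAt_smul (c : ℂ) (h : DiffAt F σ x) : DiffAt F (fun y ↦ c • σ y) x := by
  let t := trivializationAt F V x
  have hx : x ∈ t.baseSet := FiberBundle.mem_baseSet_trivializationAt' x
  unfold DiffAt at h ⊢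
  rw [mdifferentiableAt_section] at h ⊢
  have := (((c • ContinuousLinearMap.id ℂ F).restrictScalars ℝ).mdifferentiableAt).comp x h
  refine this.congr_of_eventuallyEq ?_
  filter_upwards [t.open_baseSet.mem_nhds hx] with y hy
  have := ((t.linear ℂ hy).map_smul c (σ y))
  simpa [t] using this

lemma curvatureField_smul (c : ℂ) (hY : DiffAt E4 Y x) (hZ : DiffAt E4 Z x)
    (hσ : SmoothNear F σ x) :
    A.curvatureField Y Z (fun y ↦ c • σ y) x = c • A.curvatureField Y Z σ x := by
  have key : ∀ W : Π x : X, TangentSpace (𝓡 4) x, DiffAt E4 W x → ∀ v,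
      A.toCovariantDerivative (Cov A W (fun y ↦ c • σ y)) x v =
      c • A.toCovariantDerivative (Cov A W σ) x v := by
    intro W hW v
    have e : ∀ᶠ y in 𝓝 x, Cov A W (fun y ↦ c • σ y) y = c • Cov A W σ y := by
      filter_upwards [SmoothNear.diff F hσ] with y h1
      simp [Cov, A.map_smul c _ _ h1]
    have d := diffAt_smul c (A.diffAt_cov hW hσ)
    rw [← A.map_smul c _ _ (A.diffAt_cov hW hσ)]
    congr 1
    refine A.isCovariantDerivativeOnUniv.congr_of_eventuallyEq ?_ d Filter.univ_mem e
    refine d.congr_of_eventuallyEq ?_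
    filter_upwards [e] with y hy using by rw [hy]
  simp only [curvatureField]
  unfold Cov
  have k1 := key Y hY
  have k2 := key Z hZ
  unfold Cov at k1 k2
  rw [k1, k2, A.map_smul c _ _ (SmoothNear.diffAt F hσ)]
  simp only [smul_sub]

/-- The curvature on tangent vectors at `x`, as an endomorphism of `V x`; the extensions used here
do not matter, since the curvature is a tensor. -/
def curvatureEnd (x : X) (u v : TangentSpace (𝓡 4) x) : V x →ₗ[ℂ] V x where
  toFun s := A.curvatureField (vecExtend u) (vecExtend v)
    (secExtend F s) x
  map_add' s t := by
    rw [secExtend_add, A.curvatureField_add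
      (SmoothNear.diffAt E4 (smoothNear_vecExtend u))
      (SmoothNear.diffAt E4 (smoothNear_vecExtend v))
      (smoothNear_secExtend s) (smoothNear_secExtend t)]
  map_smul' c s := by
    rw [secExtend_smul, A.curvatureField_smul c
      (SmoothNear.diffAt E4 (smoothNear_vecExtend u))
      (SmoothNear.diffAt E4 (smoothNear_vecExtend v))
      (smoothNear_secExtend s)]
    rfl

lemma curvatureEnd_add_left (u u' v : TangentSpace (𝓡 4) x) :
    A.curvatureEnd x (u + u') v = A.curvatureEnd x u v + A.curvatureEnd x u' v := by
  ext s
  simp only [curvatureEnd, LinearMap.coe_mk, AddHom.coe_mk, LinearMap.add_apply]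
  rw [vecExtend_add, A.curvatureField_add_left
      (SmoothNear.diffAt E4 (smoothNear_vecExtend u))
      (SmoothNear.diffAt E4 (smoothNear_vecExtend u'))
    (smoothNear_secExtend s)]

lemma curvatureEnd_smul_left (c : ℝ) (u v : TangentSpace (𝓡 4) x) :
    A.curvatureEnd x (c • u) v = c • A.curvatureEnd x u v := by
  ext s
  simp only [curvatureEnd, LinearMap.coe_mk, AddHom.coe_mk]
  rw [vecExtend_smul, A.curvatureField_smul_left c
      (SmoothNear.diffAt E4 (smoothNear_vecExtend u)) (smoothNear_secExtend s)]
  rfl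

lemma curvatureEnd_swap (u v : TangentSpace (𝓡 4) x) :
    A.curvatureEnd x v u = - A.curvatureEnd x u v := by
  ext s
  exact A.curvatureField_swap

lemma curvatureEnd_add_right (u v v' : TangentSpace (𝓡 4) x) :
    A.curvatureEnd x u (v + v') = A.curvatureEnd x u v + A.curvatureEnd x u v' := by
  rw [curvatureEnd_swap, curvatureEnd_add_left, neg_add, ← curvatureEnd_swap, ← curvatureEnd_swap]

lemma curvatureEnd_smul_right (c : ℝ) (u v : TangentSpace (𝓡 4) x) :
    A.curvatureEnd x u (c • v) = c • A.curvatureEnd x u v := by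
  rw [curvatureEnd_swap, curvatureEnd_smul_left, ← smul_neg, ← curvatureEnd_swap]

lemma curvatureEnd_self (u : TangentSpace (𝓡 4) x) : A.curvatureEnd x u u = 0 := by
  ext s
  simp [curvatureEnd, curvatureField, Cov]

/-- The curvature 2-form `F_A` at `x`, with values in `End (V x)`. -/
def curvature (x : X) : TangentSpace (𝓡 4) x [⋀^Fin 2]→ₗ[ℝ] (V x →ₗ[ℂ] V x) where
  toFun w := A.curvatureEnd x (w 0) (w 1)
  map_update_add' {inst} w i u v := by
    rw [Subsingleton.elim inst (instDecidableEqFin 2)]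
    fin_cases i
    · simp [curvatureEnd_add_left]
    · simp [curvatureEnd_add_right]
  map_update_smul' {inst} w i c u := by
    rw [Subsingleton.elim inst (instDecidableEqFin 2)]
    fin_cases i
    · simp [curvatureEnd_smul_left]
    · simp [curvatureEnd_smul_right]
  map_eq_zero_of_eq' w i j h hij := by
    have h01 : w 0 = w 1 := by
      fin_cases i <;> fin_cases j <;> simp_all
    rw [h01, curvatureEnd_self]

end ComplexConnection

/-- `A` is integrable with respect to `L`: the `(0,2)`-part of its curvature vanishes, i.e.
`F_A(u + iLu, v + iLv) = 0` for the complex bilinear extension of `F_A`; this is the equation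
`∂̄_A ∘ ∂̄_A = 0`. -/
def ComplexConnection.IsIntegrable [T2Space X] (A : ComplexConnection F V) (L : EndField X) :
    Prop :=
  ∀ (x : X) (u v : TangentSpace (𝓡 4) x),
    A.curvature x ![u, v] - A.curvature x ![L x u, L x v]
      + Complex.I • (A.curvature x ![L x u, v] + A.curvature x ![u, L x v]) = 0

/-- `A` is integrable with respect to every complex structure induced by `I, J, K`. -/
def ComplexConnection.IsHyperholomorphic [T2Space X] (A : ComplexConnection F V)
    (S : HypercomplexStructure X) : Prop :=
  ∀ a b c : ℝ, a ^ 2 + b ^ 2 + c ^ 2 = 1 → A.IsIntegrable (S.induced a b c)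

/-- `∗F_A = -F_A`. -/
def ComplexConnection.IsAntiSelfDual [T2Space X]
    [RiemannianBundle (fun x : X ↦ TangentSpace (𝓡 4) x)]
    (A : ComplexConnection F V) (S : HypercomplexStructure X) : Prop :=
  ∀ x : X, hodgeStar (S.orientation x) (A.curvature x) = -A.curvature x

end Connection

end HKT

end

noncomputable section

namespace HKT

/-! ### Two-forms on an oriented Euclidean 4-space: the Hodge star in components. -/

section Hodge

variable {T : Type*} [NormedAddCommGroup T] [InnerProductSpace ℝ T]
  {W : Type*} [AddCommGroup W] [Module ℝ W]

/-! The equivalence is linear algebra at each point, applied to the `End (V x)`-valued 2-form `β =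
F_A(x)`. For a unit vector `u` and a hyperhermitian metric, `(u, Iu, Ju, Ku)` is an oriented
orthonormal basis (`exists_orthonormalBasis`), and in such a basis anti-self-duality amounts to
three equations between the six components of `β` (`hodgeStar_eq_neg_iff`).

Integrability for `L` reads `p + i q = 0`, where `p = β(u, v) - β(Lu, Lv)` and `q = β(Lu, v) + β(u,
Lv)`. Since `β` has complex values, a single `L` does not separate `p` from `q`. But `-L` is an
induced structure too and gives `p - i q = 0`, so `p = 0`: `β` is `L`-invariant. Invariance under
`I` and `J` already yields the three equations (`hodgeStar_eq_neg_of_invariant`).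

Conversely, the copy of `sp(1)` spanned by `I`, `J`, `K` acts trivially on anti-self-dual forms.
Hence `q = 0` for every induced `L` (`add_eq_zero_of_hodgeStar_eq_neg`), and replacing `v` by `Lv`
in this identity gives `p = 0`. -/

lemma update_vecPair_one {α : Type*} (u v w : α) : Function.update ![u, v] 1 w = ![u, w] := by
  ext i
  fin_cases i <;> rfl

/-- A 2-form as a bilinear map. -/
def toBilin (β : T [⋀^Fin 2]→ₗ[ℝ] W) : T →ₗ[ℝ] T →ₗ[ℝ] W :=
  LinearMap.mk₂ ℝ (fun u v ↦ β ![u, v])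
    (fun u u' v ↦ by simpa using β.map_vecCons_add ![v] u u')
    (fun c u v ↦ by simpa using β.map_vecCons_smul ![v] c u)
    (fun u v v' ↦ by
      have h := β.map_update_add ![u, 0] 1 v v'
      rwa [update_vecPair_one, update_vecPair_one, update_vecPair_one] at h)
    (fun c u v ↦ by
      have h := β.map_update_smul ![u, 0] 1 c v
      rwa [update_vecPair_one, update_vecPair_one] at h)

@[simp] lemma toBilin_apply (β : T [⋀^Fin 2]→ₗ[ℝ] W) (u v : T) : toBilin β u v = β ![u, v] := rfl

lemma toBilin_injective : Function.Injective (toBilin : (T [⋀^Fin 2]→ₗ[ℝ] W) → _) := by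
  intro β γ h
  ext w
  have hw : w = ![w 0, w 1] := by ext i; fin_cases i <;> rfl
  rw [hw]
  exact LinearMap.congr_fun₂ h (w 0) (w 1)

lemma toBilin_swap (β : T [⋀^Fin 2]→ₗ[ℝ] W) (u v : T) : toBilin β v u = -toBilin β u v := by
  have h := β.map_swap ![u, v] (i := 0) (j := 1) (by decide)
  simp only [toBilin_apply, ← h]
  congr 1
  ext i
  fin_cases i <;> rfl

lemma toBilin_self (β : T [⋀^Fin 2]→ₗ[ℝ] W) (u : T) : toBilin β u u = 0 :=
  β.map_eq_zero_of_eq _ (i := 0) (j := 1) rfl (by decide)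

/-- The trace of a bilinear map with respect to an inner product does not depend on the orthonormal
basis. -/
lemma sum_bilin_orthonormalBasis {ι κ : Type*} [Fintype ι] [Fintype κ]
    (e : OrthonormalBasis ι ℝ T) (f : OrthonormalBasis κ ℝ T) (B : T →ₗ[ℝ] T →ₗ[ℝ] W) :
    ∑ i, B (e i) (e i) = ∑ j, B (f j) (f j) := by
  classical
  -- Both slots are expanded in `f`; summing over `i` then turns the coefficients into `⟪f j, f k⟫`
  -- by Parseval.
  have h1 : ∀ i, B (e i) (e i) = ∑ j, ∑ k, (⟪f j, e i⟫_ℝ * ⟪e i, f k⟫_ℝ) • B (f j) (f k) := by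
    intro i
    conv_lhs => rw [← f.sum_repr' (e i)]
    simp only [map_sum, map_smul, LinearMap.sum_apply, LinearMap.smul_apply, Finset.smul_sum,
      smul_smul]
    rw [Finset.sum_comm]
    simp only [real_inner_comm, mul_comm]
  simp only [h1]
  rw [Finset.sum_comm]
  refine Finset.sum_congr rfl fun j _ ↦ ?_
  rw [Finset.sum_comm]
  simp only [← Finset.sum_smul, e.sum_inner_mul_inner, f.inner_eq_ite]
  simp

/-- The double sum is a trace over `i` of a trace over `j`, and each trace is independent of the
basis. With `G` a contracted volume form and `H = β`, this frees the Hodge star from the basis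
chosen in its definition. The index types differ because `stdOrthonormalBasis` is indexed by `Fin
(finrank ℝ T)`. -/
lemma sum_smul_bilin_orthonormalBasis {ι κ : Type*} [Fintype ι] [Fintype κ]
    (e : OrthonormalBasis ι ℝ T) (f : OrthonormalBasis κ ℝ T)
    (G : T →ₗ[ℝ] T →ₗ[ℝ] ℝ) (H : T →ₗ[ℝ] T →ₗ[ℝ] W) :
    ∑ i, ∑ j, G (e i) (e j) • H (e i) (e j) = ∑ i, ∑ j, G (f i) (f j) • H (f i) (f j) := by
  have inner : ∀ a b, ∑ j, G a (e j) • H b (e j) = ∑ j, G a (f j) • H b (f j) := fun a b ↦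
    sum_bilin_orthonormalBasis e f (LinearMap.mk₂ ℝ (fun c d ↦ G a c • H b d)
      (by simp [add_smul]) (by simp [mul_smul]) (by simp) (fun c a b ↦ by rw [map_smul, smul_comm]))
  simp only [inner]
  exact sum_bilin_orthonormalBasis e f (LinearMap.mk₂ ℝ (fun a b ↦ ∑ j, G a (f j) • H b (f j))
    (by simp [add_smul, Finset.sum_add_distrib]) (by simp [mul_smul, Finset.smul_sum])
    (by simp [Finset.sum_add_distrib])
    (fun c a b ↦ by simp only [map_smul, LinearMap.smul_apply, Finset.smul_sum, smul_comm c]))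

variable [Fact (Module.finrank ℝ T = 4)]

/-- The Hodge star may be computed in any orthonormal basis. -/
lemma hodgeStar_eq_sum (o : Orientation ℝ T (Fin 4)) (β : T [⋀^Fin 2]→ₗ[ℝ] W)
    (f : OrthonormalBasis (Fin 4) ℝ T) (u v : T) :
    hodgeStar o β ![u, v] =
      (1 / 2 : ℝ) • ∑ i, ∑ j, o.volumeForm ![f i, f j, u, v] • β ![f i, f j] := by
  have : FiniteDimensional ℝ T := .of_fact_finrank_eq_succ 3
  have key := sum_smul_bilin_orthonormalBasis (stdOrthonormalBasis ℝ T) f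
    (LinearMap.mk₂ ℝ (fun a c ↦ (o.volumeForm.curryLeft a).curryLeft c ![u, v])
      (by simp) (by simp) (by simp) (by simp)) (toBilin β)
  rw [hodgeStar, AlternatingMap.smul_apply]
  congr 1
  refine Eq.trans ?_ key
  let ev : (T [⋀^Fin 2]→ₗ[ℝ] W) →+ W :=
    { toFun γ := γ ![u, v], map_zero' := rfl, map_add' _ _ := rfl }
  exact (map_sum ev _ _).trans (Finset.sum_congr rfl fun i _ ↦ map_sum ev _ _)

/-- The Levi-Civita symbol in dimension 4. -/
def leviCivita (i j k l : Fin 4) : ℤ :=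
  -- Integer entries keep the values decidable by evaluation.
  (Matrix.of fun p q : Fin 4 ↦ if ![i, j, k, l] q = p then (1 : ℤ) else 0).det

/-- The volume form of an oriented orthonormal basis takes the values of the Levi-Civita symbol. -/
lemma volumeForm_orthonormalBasis (f : OrthonormalBasis (Fin 4) ℝ T) (i j k l : Fin 4) :
    f.toBasis.orientation.volumeForm ![f i, f j, f k, f l] = (leviCivita i j k l : ℝ) := by
  have hv : ![f i, f j, f k, f l] = fun q ↦ f (![i, j, k, l] q) := by
    ext1 q
    fin_cases q <;> rfl
  rw [f.toBasis.orientation.volumeForm_robust f rfl, Module.Basis.det_apply, hv,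
    leviCivita, Int.cast_det]
  congr 1
  ext p q
  have h : f.repr (f (![i, j, k, l] q)) p = if p = ![i, j, k, l] q then 1 else 0 := by
    simp [f.repr_self]
  simp only [Module.Basis.toMatrix_apply, OrthonormalBasis.coe_toBasis_repr_apply, h,
    Matrix.map_apply, Matrix.of_apply, eq_comm (a := p)]
  split_ifs <;> simp

/-- The hypothesis `h` says that `(i, j, k, l)` is an even permutation of the indices. Only the
terms `(i, j)` and `(j, i)` survive in the sum; they are equal by antisymmetry, which cancels the
factor `1/2`. -/
lemma toBilin_hodgeStar_orthonormalBasis (f : OrthonormalBasis (Fin 4) ℝ T)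
    (β : T [⋀^Fin 2]→ₗ[ℝ] W) {i j k l : Fin 4}
    (h : ∀ p q, leviCivita p q k l = (if p = i ∧ q = j then 1 else 0) -
      if p = j ∧ q = i then 1 else 0) :
    toBilin (hodgeStar f.toBasis.orientation β) (f k) (f l) = toBilin β (f i) (f j) := by
  have hsw := toBilin_swap β (f i) (f j)
  rw [toBilin_apply, hodgeStar_eq_sum _ β f]
  simp only [volumeForm_orthonormalBasis, h, ← toBilin_apply, Int.cast_sub, Int.cast_ite,
    Int.cast_one, Int.cast_zero, sub_smul, ite_smul, one_smul, zero_smul, Finset.sum_sub_distrib,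
    ite_and, Finset.sum_ite_eq', Finset.sum_ite_irrel, Finset.sum_const_zero, Finset.mem_univ,
    if_true, hsw]
  module

/-- A 2-form is anti-self-dual if and only if its components in an oriented orthonormal basis
satisfy the three anti-self-duality equations. -/
lemma hodgeStar_eq_neg_iff (f : OrthonormalBasis (Fin 4) ℝ T) (β : T [⋀^Fin 2]→ₗ[ℝ] W) :
    hodgeStar f.toBasis.orientation β = -β ↔
      toBilin β (f 2) (f 3) = -toBilin β (f 0) (f 1) ∧
      toBilin β (f 1) (f 3) = toBilin β (f 0) (f 2) ∧
      toBilin β (f 1) (f 2) = -toBilin β (f 0) (f 3) := by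
  set s := toBilin (hodgeStar f.toBasis.orientation β) with hs
  set b := toBilin β with hb
  have h01 : s (f 0) (f 1) = b (f 2) (f 3) :=
    toBilin_hodgeStar_orthonormalBasis f β (by decide +kernel)
  have h23 : s (f 2) (f 3) = b (f 0) (f 1) :=
    toBilin_hodgeStar_orthonormalBasis f β (by decide +kernel)
  -- The even completion of `(0, 2)` is `(3, 1)`, and that of `(1, 3)` is `(2, 0)`; reordering these
  -- pairs produces the two minus signs.
  have h02 : s (f 0) (f 2) = -b (f 1) (f 3) :=
    (toBilin_hodgeStar_orthonormalBasis f β (by decide +kernel)).trans (toBilin_swap β (f 1) (f 3))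
  have h13 : s (f 1) (f 3) = -b (f 0) (f 2) :=
    (toBilin_hodgeStar_orthonormalBasis f β (by decide +kernel)).trans (toBilin_swap β (f 0) (f 2))
  have h03 : s (f 0) (f 3) = b (f 1) (f 2) :=
    toBilin_hodgeStar_orthonormalBasis f β (by decide +kernel)
  have h12 : s (f 1) (f 2) = b (f 0) (f 3) :=
    toBilin_hodgeStar_orthonormalBasis f β (by decide +kernel)
  have neg : toBilin (-β) = -b := rfl
  constructor
  · intro h
    have h' : s = -b := by rw [hs, h, neg]
    refine ⟨?_, ?_, ?_⟩
    · rw [← h01, h']; rfl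
    · rw [← neg_inj, ← h02, h']; rfl
    · rw [← h03, h']; rfl
  · rintro ⟨e1, e2, e3⟩
    apply toBilin_injective
    rw [neg]
    refine LinearMap.ext_basis f.toBasis f.toBasis fun i j ↦ ?_
    have sw : ∀ u v, s u v = (-b) u v → s v u = (-b) v u := fun u v h ↦ by
      rw [hs, toBilin_swap, ← hs, h, LinearMap.neg_apply, LinearMap.neg_apply, hb,
        LinearMap.neg_apply, LinearMap.neg_apply, toBilin_swap β u v]
    have self : ∀ u, s u u = (-b) u u := fun u ↦ by
      rw [hs, toBilin_self, LinearMap.neg_apply, LinearMap.neg_apply, hb, toBilin_self, neg_zero]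
    have k01 : s (f 0) (f 1) = (-b) (f 0) (f 1) := by rw [h01, e1]; rfl
    have k02 : s (f 0) (f 2) = (-b) (f 0) (f 2) := by rw [h02, e2]; rfl
    have k03 : s (f 0) (f 3) = (-b) (f 0) (f 3) := by rw [h03, e3]; rfl
    have k12 : s (f 1) (f 2) = (-b) (f 1) (f 2) := by rw [h12]; simp [e3]
    have k13 : s (f 1) (f 3) = (-b) (f 1) (f 3) := by rw [h13]; simp [e2]
    have k23 : s (f 2) (f 3) = (-b) (f 2) (f 3) := by rw [h23]; simp [e1]
    simp only [OrthonormalBasis.coe_toBasis]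
    fin_cases i <;> fin_cases j
    exacts [self _, k01, k02, k03, sw _ _ k01, self _, k12, k13, sw _ _ k02, sw _ _ k12, self _, k23,
      sw _ _ k03, sw _ _ k13, sw _ _ k23, self _]

end Hodge

/-! ### Quaternionic relations and oriented orthonormal quaternionic frames. -/

section Frame

variable {X : Type*} [TopologicalSpace X] [ChartedSpace E4 X] [IsManifold (𝓡 4) ∞ X]
  (S : HypercomplexStructure X) {x : X}

namespace HypercomplexStructure

lemma I_K (v : TangentSpace (𝓡 4) x) : S.I x (S.K x v) = -S.J x v := by
  rw [← S.I_J, S.isComplex_I.sq]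

lemma K_J (v : TangentSpace (𝓡 4) x) : S.K x (S.J x v) = -S.I x v := by
  rw [← S.I_J, S.isComplex_J.sq, map_neg]

lemma K_I (v : TangentSpace (𝓡 4) x) : S.K x (S.I x v) = S.J x v := by
  rw [← S.I_J, S.J_I, map_neg, S.I_K, neg_neg]

lemma J_K (v : TangentSpace (𝓡 4) x) : S.J x (S.K x v) = S.I x v := by
  rw [← neg_eq_iff_eq_neg.2 (S.J_I x v), map_neg, S.isComplex_J.sq, neg_neg]

lemma coe_frame {u : TangentSpace (𝓡 4) x} (hu : u ≠ 0) :
    ⇑(S.frame hu) = ![u, S.I x u, S.J x u, S.K x u] :=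
  coe_basisOfLinearIndependentOfCardEqFinrank _ _

/-- The change of basis has determinant `c ^ 4 > 0`. This permits normalizing the arbitrary vector
used to define `S.orientation`. -/
lemma orientation_frame_smul {u : TangentSpace (𝓡 4) x} (hu : u ≠ 0) {c : ℝ} (hc : c • u ≠ 0) :
    (S.frame hc).orientation = (S.frame hu).orientation := by
  have hv : ⇑(S.frame hc) = fun i ↦ c • S.frame hu i := by
    rw [coe_frame, coe_frame]
    ext1 i
    fin_cases i <;> simp
  rw [eq_comm, Module.Basis.orientation_eq_iff_det_pos, hv, AlternatingMap.map_smul_univ,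
    Module.Basis.det_self]
  have : c ≠ 0 := fun h ↦ hc (by simp [h])
  simp only [Finset.prod_const, Finset.card_univ, Fintype.card_fin, smul_eq_mul, mul_one]
  positivity

lemma induced_apply (a b c : ℝ) (v : TangentSpace (𝓡 4) x) :
    S.induced a b c x v = a • S.I x v + b • S.J x v + c • S.K x v := rfl

lemma induced_sq {a b c : ℝ} (h : a ^ 2 + b ^ 2 + c ^ 2 = 1) (v : TangentSpace (𝓡 4) x) :
    S.induced a b c x (S.induced a b c x v) = -v := by
  -- In this form the claim is a polynomial identity in `a`, `b`, `c`: the mixed terms cancel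
  -- because `I`, `J`, `K` anticommute.
  have : -v = -((a ^ 2 + b ^ 2 + c ^ 2) • v) := by rw [h, one_smul]
  rw [this]
  simp only [induced_apply, map_add, map_smul, S.I_J, S.J_I, S.I_K, S.K_J, S.K_I, S.J_K,
    S.isComplex_I.sq, S.isComplex_J.sq, S.isComplex_K.sq]
  module

variable {S} [RiemannianBundle (fun x : X ↦ TangentSpace (𝓡 4) x)]

/-- `g(u, Lu) = g(Lu, L²u) = -g(Lu, u)`. -/
lemma _root_.HKT.IsHermitian.inner_self_eq_zero {L : EndField X} (hg : IsHermitian L)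
    (hL : IsComplexStructure L) (u : TangentSpace (𝓡 4) x) : ⟪u, L x u⟫_ℝ = 0 := by
  have h := hg x u (L x u)
  rw [hL.sq, inner_neg_right, real_inner_comm] at h
  linarith

/-- For a hyperhermitian metric and a unit vector `u`, the basis `(u, Iu, Ju, Ku)` is
orthonormal. -/
lemma IsHyperhermitian.orthonormal_frame (hS : S.IsHyperhermitian) {u : TangentSpace (𝓡 4) x}
    (hu : u ≠ 0) (h1 : ‖u‖ = 1) : Orthonormal ℝ (S.frame hu) := by
  have uu : ⟪u, u⟫_ℝ = 1 := by rw [real_inner_self_eq_norm_sq, h1, one_pow]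
  have uI := hS.I.inner_self_eq_zero S.isComplex_I u
  have uJ := hS.J.inner_self_eq_zero S.isComplex_J u
  have uK := hS.K.inner_self_eq_zero S.isComplex_K u
  -- Each mixed product reduces to some `g(u, Lu) = 0` by removing a common `I` or `J`, after
  -- writing `J = -IK`, `K = IJ` or `K = -JI`.
  have IJ : ⟪S.I x u, S.J x u⟫_ℝ = 0 := by
    have := hS.I x u (S.K x u)
    rwa [uK, S.I_K, inner_neg_right, neg_eq_zero] at this
  have IK : ⟪S.I x u, S.K x u⟫_ℝ = 0 := by
    rw [← S.I_J, hS.I, uJ]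
  have JK : ⟪S.J x u, S.K x u⟫_ℝ = 0 := by
    have := hS.J x u (S.I x u)
    rwa [uI, S.J_I, inner_neg_right, neg_eq_zero] at this
  rw [orthonormal_iff_ite, coe_frame]
  intro i j
  have sym : ∀ p q : TangentSpace (𝓡 4) x, ⟪p, q⟫_ℝ = 0 → ⟪q, p⟫_ℝ = 0 := fun p q h ↦ by
    rw [real_inner_comm, h]
  fin_cases i <;> fin_cases j
  exacts [uu, uI, uJ, uK, sym _ _ uI, (hS.I x u u).trans uu, IJ, IK,
    sym _ _ uJ, sym _ _ IJ, (hS.J x u u).trans uu, JK,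
    sym _ _ uK, sym _ _ IK, sym _ _ JK, (hS.K x u u).trans uu]

/-- Every tangent space has an oriented orthonormal basis of the form `(u, Iu, Ju, Ku)`. -/
lemma IsHyperhermitian.exists_orthonormalBasis (hS : S.IsHyperhermitian) (x : X) :
    ∃ f : OrthonormalBasis (Fin 4) ℝ (TangentSpace (𝓡 4) x),
      f.toBasis.orientation = S.orientation x ∧
      S.I x (f 0) = f 1 ∧ S.J x (f 0) = f 2 ∧ S.K x (f 0) = f 3 := by
  -- The same choice of vector as in `HypercomplexStructure.orientation`, so that only a rescaling
  -- to unit length separates the two frames.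
  set u := (exists_ne (0 : TangentSpace (𝓡 4) x)).choose
  have hu : u ≠ 0 := (exists_ne (0 : TangentSpace (𝓡 4) x)).choose_spec
  have hn : ‖u‖ ≠ 0 := norm_ne_zero_iff.2 hu
  have hc : ‖u‖⁻¹ • u ≠ 0 := smul_ne_zero (inv_ne_zero hn) hu
  have h1 : ‖‖u‖⁻¹ • u‖ = 1 := by rw [norm_smul, norm_inv, norm_norm, inv_mul_cancel₀ hn]
  refine ⟨(S.frame hc).toOrthonormalBasis (hS.orthonormal_frame hc h1), ?_, ?_⟩
  · rw [Module.Basis.toBasis_toOrthonormalBasis]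
    exact S.orientation_frame_smul hu hc
  · simp only [Module.Basis.coe_toOrthonormalBasis, coe_frame]
    exact ⟨rfl, rfl, rfl⟩

end HypercomplexStructure

end Frame

/-! ### Anti-self-duality and the action of the induced complex structures on 2-forms. -/

section TwoForm

variable {X : Type*} [TopologicalSpace X] [ChartedSpace E4 X] [IsManifold (𝓡 4) ∞ X]
  [RiemannianBundle (fun x : X ↦ TangentSpace (𝓡 4) x)]
  {S : HypercomplexStructure X} {x : X} {W : Type*} [AddCommGroup W] [Module ℝ W]

lemma eq_zero_of_add_eq_zero_of_sub_eq_zero {W : Type*} [AddCommGroup W] [Module ℂ W] {p q : W}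
    (h₁ : p + q = 0) (h₂ : p - q = 0) : p = 0 := by
  rw [← sub_eq_zero.1 h₂, ← two_smul ℂ] at h₁
  exact (smul_eq_zero.1 h₁).resolve_left two_ne_zero

namespace HypercomplexStructure.IsHyperhermitian

/-- A 2-form that is invariant under `I` and `J` is anti-self-dual. -/
lemma hodgeStar_eq_neg_of_invariant (hS : S.IsHyperhermitian)
    (β : TangentSpace (𝓡 4) x [⋀^Fin 2]→ₗ[ℝ] W)
    (hI : ∀ u v, toBilin β (S.I x u) (S.I x v) = toBilin β u v)
    (hJ : ∀ u v, toBilin β (S.J x u) (S.J x v) = toBilin β u v) :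
    hodgeStar (S.orientation x) β = -β := by
  obtain ⟨f, ho, f1, f2, f3⟩ := hS.exists_orthonormalBasis x
  rw [← ho, hodgeStar_eq_neg_iff]
  refine ⟨?_, ?_, ?_⟩
  -- `J` maps the pair `(f 0, f 1)` to `(f 2, -f 3)`; in the next two equations `I` maps `(f 0, f
  -- 2)` to `(f 1, f 3)` and `(f 0, f 3)` to `(f 1, -f 2)`.
  · rw [← hJ (f 0), f2, ← f1, S.J_I, f3, map_neg, neg_neg]
  · rw [← hI (f 0), f1, ← f2, S.I_J, f3]
  · rw [← hI (f 0), f1, ← f3, S.I_K, f2, map_neg, neg_neg]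

/-- The induced complex structures annihilate anti-self-dual 2-forms, acting as derivations. -/
lemma add_eq_zero_of_hodgeStar_eq_neg (hS : S.IsHyperhermitian)
    (β : TangentSpace (𝓡 4) x [⋀^Fin 2]→ₗ[ℝ] W) (h : hodgeStar (S.orientation x) β = -β)
    (a b c : ℝ) (u v : TangentSpace (𝓡 4) x) :
    toBilin β (S.induced a b c x u) v + toBilin β u (S.induced a b c x v) = 0 := by
  obtain ⟨f, ho, f1, f2, f3⟩ := hS.exists_orthonormalBasis x
  rw [← ho, hodgeStar_eq_neg_iff] at h
  obtain ⟨e1, e2, e3⟩ := h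
  -- The derivation action of `L` on `β` is bilinear, so it is enough to evaluate it on the 16 pairs
  -- of basis vectors. There `L` acts as left multiplication by the quaternion `ai + bj + ck` on `1,
  -- i, j, k`.
  let D : TangentSpace (𝓡 4) x →ₗ[ℝ] TangentSpace (𝓡 4) x →ₗ[ℝ] W :=
    (toBilin β).compl₁₂ (S.induced a b c x).toLinearMap LinearMap.id +
      (toBilin β).compl₁₂ LinearMap.id (S.induced a b c x).toLinearMap
  suffices D = 0 from LinearMap.congr_fun₂ this u v
  refine LinearMap.ext_basis f.toBasis f.toBasis fun i j ↦ ?_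
  have L0 : S.induced a b c x (f 0) = a • f 1 + b • f 2 + c • f 3 := by
    rw [induced_apply, f1, f2, f3]
  have L1 : S.induced a b c x (f 1) = -a • f 0 - b • f 3 + c • f 2 := by
    rw [induced_apply, ← f1, S.J_I, S.K_I, S.isComplex_I.sq, f2, f3]
    module
  have L2 : S.induced a b c x (f 2) = a • f 3 - b • f 0 - c • f 1 := by
    rw [induced_apply, ← f2, S.I_J, S.K_J, S.isComplex_J.sq, f1, f3]
    module
  have L3 : S.induced a b c x (f 3) = -a • f 2 + b • f 1 - c • f 0 := by
    rw [induced_apply, ← f3, S.I_K, S.J_K, S.isComplex_K.sq, f1, f2]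
    module
  have hD : ∀ p q, D p q =
      toBilin β (S.induced a b c x p) q + toBilin β p (S.induced a b c x q) := fun _ _ ↦ rfl
  have s10 := toBilin_swap β (f 0) (f 1)
  have s20 := toBilin_swap β (f 0) (f 2)
  have s30 := toBilin_swap β (f 0) (f 3)
  have s21 := toBilin_swap β (f 1) (f 2)
  have s31 := toBilin_swap β (f 1) (f 3)
  have s32 := toBilin_swap β (f 2) (f 3)
  -- With the anti-self-duality equations, every component of `β` is expressed by those at `(0, 1)`,
  -- `(0, 2)`, `(0, 3)`.
  rw [e1] at s32
  rw [e2] at s31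
  rw [e3] at s21
  simp only [OrthonormalBasis.coe_toBasis, hD, LinearMap.zero_apply]
  fin_cases i <;> fin_cases j <;>
  · simp only [Fin.zero_eta, Fin.mk_one, Fin.reduceFinMk, L0, L1, L2, L3, map_add, map_sub, map_smul,
      LinearMap.add_apply, LinearMap.sub_apply, LinearMap.smul_apply, toBilin_self, s10, s20, s30,
      s21, s31, s32, e1, e2, e3]
    module

end HypercomplexStructure.IsHyperhermitian

end TwoForm

end HKT

end

theorem mainTheorem4
    -- a compact 4-manifold `X` with a Riemannian metric
    {X : Type*} [TopologicalSpace X] [T2Space X] [CompactSpace X]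
    [ChartedSpace HKT.E4 X] [IsManifold (𝓡 4) ∞ X]
    [RiemannianBundle (fun x : X ↦ TangentSpace (𝓡 4) x)]
    [IsContMDiffRiemannianBundle (𝓡 4) ∞ HKT.E4 (fun x : X ↦ TangentSpace (𝓡 4) x)]
    -- a hypercomplex structure for which the metric is strong HKT
    (S : HKT.HypercomplexStructure X) (hS : S.IsStrongHKT)
    -- a smooth complex vector bundle `V` on `X` with a Hermitian metric
    {F : Type*} [NormedAddCommGroup F] [NormedSpace ℂ F] [FiniteDimensional ℂ F]
    {V : X → Type*} [TopologicalSpace (TotalSpace F V)]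
    [∀ x, AddCommGroup (V x)] [∀ x, Module ℂ (V x)] [∀ x, TopologicalSpace (V x)]
    [∀ x, IsTopologicalAddGroup (V x)] [∀ x, ContinuousSMul ℝ (V x)]
    [FiberBundle F V] [VectorBundle ℂ F V] [VectorBundle ℝ F V]
    [ContMDiffVectorBundle ∞ F V (𝓡 4)]
    (h : HKT.HermitianMetric F V)
    -- a unitary connection
    (A : HKT.ComplexConnection F V) (hA : A.IsUnitary h) :
    A.IsHyperholomorphic S ↔ A.IsAntiSelfDual S := by
  constructor
  · intro hH x
    -- the integrability conditions for `L` and `-L` add up to `L`-invariance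
    have inv : ∀ a b c : ℝ, a ^ 2 + b ^ 2 + c ^ 2 = 1 → ∀ u v : TangentSpace (𝓡 4) x,
        HKT.toBilin (A.curvature x) (S.induced a b c x u) (S.induced a b c x v) =
          HKT.toBilin (A.curvature x) u v := by
      intro a b c habc u v
      have h1 := hH a b c habc x u v
      have h2 := hH (-a) (-b) (-c) (by simpa using habc) x u v
      have hneg : ∀ w, S.induced (-a) (-b) (-c) x w = -S.induced a b c x w := fun w ↦ by
        simp only [S.induced_apply]
        module
      simp only [hneg, ← HKT.toBilin_apply, map_neg, LinearMap.neg_apply, neg_neg] at h1 h2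
      rw [← neg_add, smul_neg, ← sub_eq_add_neg] at h2
      exact (sub_eq_zero.1 (HKT.eq_zero_of_add_eq_zero_of_sub_eq_zero h1 h2)).symm
    refine hS.hyperhermitian.hodgeStar_eq_neg_of_invariant _ (fun u v ↦ ?_) fun u v ↦ ?_
    -- The coefficients `(1, 0, 0)` and `(0, 1, 0)` select `I` and `J`.
    · simpa [S.induced_apply] using inv 1 0 0 (by norm_num) u v
    · simpa [S.induced_apply] using inv 0 1 0 (by norm_num) u v
  · intro hasd a b c habc x u v
    have hL := hS.hyperhermitian.add_eq_zero_of_hodgeStar_eq_neg _ (hasd x) a b c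
    -- Since `L² = -1`, the derivation identity at `(u, Lv)` becomes `L`-invariance, `β(Lu, Lv) =
    -- β(u, v)`; at `(u, v)` it kills the term with `Complex.I`.
    have h1 := hL u (S.induced a b c x v)
    rw [S.induced_sq habc, map_neg, ← sub_eq_add_neg, sub_eq_zero] at h1
    simp only [← HKT.toBilin_apply]
    rw [hL u v, h1, sub_self, smul_zero, add_zero]
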